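/- Let $\mathcal S,\mathcal A,\mathcal C$ be finite sets of states, actions and tasks, $P(s'\mid s,a)$ transition probabilities, $\rho_0$ an initial state distribution, $p$ a distribution on $\mathcal C$, and $\gamma\in[0,1)$. Let $\Pi$ be the set of task-conditioned stationary stochastic policies $\pi(a\mid s,c)$. For $\pi\in\Pi$ draw $c\sim p$ (fixed along the trajectory), $s_0\sim\rho_0$, $a_t\sim\pi(\cdot\mid s_t,c)$, $s_{t+1}\sim P(\cdot\mid s_t,a_t)$, and put $$\mathbb E_\pi[l]=\mathbb E\Big[\sum_{t\ge 0}\gamma^t\, l(s_t,a_t,c)\Big],\qquad H(\pi)=\mathbb E_\pi[-\log\pi(a\mid s,c)],\qquad \rho_\pi(s,a,c)=p(c)\sum_{t\ge0}\gamma^t\Pr(s_t=s,a_t=a\mid \pi,c).$$ Let $\mathcal M$ be the set of all $\rho\ge 0$ on $\mathcal S\times\mathcal A\times\mathcal C$ with $\sum_a\rho(s,a,c)=p(c)\rho_0(s)+\gamma\sum_{s',a}P(s\mid s',a)\rho(s',a,c)$ for all $s,c$, and for $\rho\in\mathcal M$ let $H(\rho)=-\sum_{s,a,c}\rho(s,a,c)\log\big(\rho(s,a,c)/\sum_{a'}\rho(s,a',c)\big)$.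 Let $\pi_E\in\Pi$ be the expert, $\rho_E=\rho_{\pi_E}$, and let $\psi:\mathbb R^{\mathcal S\times\mathcal A\times\mathcal C}\to\overline{\mathbb R}$ be a proper convex function with conjugate $\psi^*(x)=\sup_l\big(\sum_{s,a,c} x\,l-\psi(l)\big)$. For cost functions $l\in\mathbb R^{\mathcal S\times\mathcal A\times\mathcal C}$ define $$\mathrm{RL}(l)=\operatorname*{argmin}_{\pi\in\Pi}\; -H(\pi)+\mathbb E_\pi[l],\qquad \mathrm{IRL}=\operatorname*{argmax}_{l}\; -\psi(l)+\Big(\min_{\pi\in\Pi}-H(\pi)+\mathbb E_\pi[l]\Big)-\mathbb E_{\pi_E}[l],$$ $\mathrm{RL}\circ\mathrm{IRL}=\bigcup_{l\in\mathrm{IRL}}\mathrm{RL}(l)$, and $$\mathrm{Sol}=\operatorname*{argmin}_{\pi\in\Pi}\; -H(\pi)+\psi^*(\rho_\pi-\rho_E).$$ Then: 1. $\mathrm{Sol}$ and every $\mathrm{RL}(l)$ are non-empty, and the supremum of the IRL objective over $l$ equals the minimum of $-H(\pi)+\psi^*(\rho_\pi-\rho_E)$ over $\pi\in\Pi$. 2.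 $\mathrm{RL}(l)=\mathrm{Sol}$ for every $l\in\mathrm{IRL}$. Hence, if the IRL problem has a solution, $\mathrm{RL}\circ\mathrm{IRL}=\mathrm{Sol}$. 3. If the IRL problem has a solution, the function $L(\rho,l)=-H(\rho)+\sum_{s,a,c}(\rho-\rho_E)\,l-\psi(l)$ has a saddle point on $\mathcal M\times\mathbb R^{\mathcal S\times\mathcal A\times\mathcal C}$ (minimum in $\rho$, maximum in $l$). In all cases its saddle points are exactly the pairs $(\rho_\pi,l)$ with $l\in\mathrm{IRL}$ and $\pi\in\mathrm{RL}(l)$. 4. The IRL problem has a solution whenever $\psi$ is lower semicontinuous and all its sublevel sets $\{\psi\le r\}$, $r\in\mathbb R$, are bounded. -/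

import Mathlib

namespace TaskIRL

noncomputable section

/-- A finite Markov decision process with dynamics `P s a s' = P(s' | s, a)`, initial state
distribution `ρ₀`, discount factor `γ ∈ [0, 1)`, together with a distribution `p` of the task
variable `c`. The task is drawn once, from `p`, and stays fixed along the trajectory. -/
structure TaskMDP (S A C : Type*) [Fintype S] [Fintype A] [Fintype C] where
  P : S → A → S → ℝ
  P_mem : ∀ s a, P s a ∈ stdSimplex ℝ S
  ρ₀ : S → ℝ
  ρ₀_mem : ρ₀ ∈ stdSimplex ℝ S
  γ : ℝ
  γ_nonneg : 0 ≤ γ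
  γ_lt_one : γ < 1
  p : C → ℝ
  p_mem : p ∈ stdSimplex ℝ C

/-- The set `Π` of task-conditioned stationary stochastic policies; `π s c a = π(a | s, c)`. -/
def policies (S A C : Type*) [Fintype A] : Set (S → C → A → ℝ) :=
  {π | ∀ s c, π s c ∈ stdSimplex ℝ A}

/-- Convexity of an extended-real-valued function: its epigraph is convex. -/
def ConvexFun {E : Type*} [AddCommGroup E] [Module ℝ E] (ψ : E → EReal) : Prop :=
  Convex ℝ {q : E × ℝ | ψ q.1 ≤ (q.2 : EReal)}

/-- A proper function: never `-∞`, and finite somewhere. -/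
def ProperFun {E : Type*} (ψ : E → EReal) : Prop :=
  (∀ l, ψ l ≠ ⊥) ∧ ∃ l, ψ l ≠ ⊤

/-- The convex conjugate `ψ*(x) = sup_l (⟨x, l⟩ - ψ(l))`. -/
def conjugate {ι : Type*} [Fintype ι] (ψ : (ι → ℝ) → EReal) (x : ι → ℝ) : EReal :=
  ⨆ l : ι → ℝ, ((∑ i, x i * l i : ℝ) : EReal) - ψ l

namespace TaskMDP

variable {S A C : Type*} [Fintype S] [Fintype A] [Fintype C]

/-- `stateProb M π c t s` is the probability that `s_t = s` when `s_0 ∼ ρ₀`,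
`a_t ∼ π(· | s_t, c)` and `s_{t+1} ∼ P(· | s_t, a_t)`, given the task `c`. -/
def stateProb (M : TaskMDP S A C) (π : S → C → A → ℝ) (c : C) : ℕ → S → ℝ
  | 0 => M.ρ₀
  | t + 1 => fun s' => ∑ s, ∑ a, stateProb M π c t s * π s c a * M.P s a s'

/-- The discounted expectation `E_{c ∼ p, π} [∑_t γ^t l(s_t, a_t, c)]`. -/
def expect (M : TaskMDP S A C) (π : S → C → A → ℝ) (l : S × A × C → ℝ) : ℝ :=
  ∑' t : ℕ, M.γ ^ t *
    ∑ c, M.p c * ∑ s, ∑ a, M.stateProb π c t s * π s c a * l (s, a, c)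

/-- The discounted causal entropy `H(π) = E_{c, π} [- log π(a | s, c)]`. -/
def entropy (M : TaskMDP S A C) (π : S → C → A → ℝ) : ℝ :=
  M.expect π fun x => - Real.log (π x.1 x.2.2 x.2.1)

/-- The task-extended occupancy measure
`ρ_π(s, a, c) = p(c) ∑_t γ^t P(s_t = s, a_t = a | π, c)`. -/
def occupancy (M : TaskMDP S A C) (π : S → C → A → ℝ) : S × A × C → ℝ :=
  fun x => M.p x.2.2 *
    ∑' t : ℕ, M.γ ^ t * (M.stateProb π x.2.2 t x.1 * π x.1 x.2.2 x.2.1)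

/-- Entropy-regularized reinforcement learning for the cost `l`:
`argmin_{π ∈ Π} - H(π) + E_π[l]`. -/
def RL (M : TaskMDP S A C) (l : S × A × C → ℝ) : Set (S → C → A → ℝ) :=
  {π | π ∈ policies S A C ∧ ∀ π' ∈ policies S A C,
    - M.entropy π + M.expect π l ≤ - M.entropy π' + M.expect π' l}

/-- The objective of maximum-entropy inverse reinforcement learning with regularizer `ψ`:
`- ψ(l) + (min_{π ∈ Π} - H(π) + E_π[l]) - E_{π_E}[l]`. -/
def irlObjective (M : TaskMDP S A C) (ψ : (S × A × C → ℝ) → EReal) (πE : S → C → A → ℝ)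
    (l : S × A × C → ℝ) : EReal :=
  (⨅ π ∈ policies S A C, ((- M.entropy π + M.expect π l : ℝ) : EReal))
    - ((M.expect πE l : ℝ) : EReal) - ψ l

/-- The solutions of inverse reinforcement learning: the costs maximizing `irlObjective`. -/
def IRL (M : TaskMDP S A C) (ψ : (S × A × C → ℝ) → EReal) (πE : S → C → A → ℝ) :
    Set (S × A × C → ℝ) :=
  {l | ∀ l', M.irlObjective ψ πE l' ≤ M.irlObjective ψ πE l}

/-- The composition `RL ∘ IRL`: all policies obtained by reinforcement learning on a cost
recovered by inverse reinforcement learning. -/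
def RLcompIRL (M : TaskMDP S A C) (ψ : (S × A × C → ℝ) → EReal) (πE : S → C → A → ℝ) :
    Set (S → C → A → ℝ) :=
  {π | ∃ l ∈ M.IRL ψ πE, π ∈ M.RL l}

/-- The objective `- H(π) + ψ*(ρ_π - ρ_E)`. -/
def objective (M : TaskMDP S A C) (ψ : (S × A × C → ℝ) → EReal) (πE π : S → C → A → ℝ) :
    EReal :=
  ((- M.entropy π : ℝ) : EReal) + conjugate ψ (M.occupancy π - M.occupancy πE)

/-- `argmin_{π ∈ Π} - H(π) + ψ*(ρ_π - ρ_E)`. -/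
def solutions (M : TaskMDP S A C) (ψ : (S × A × C → ℝ) → EReal) (πE : S → C → A → ℝ) :
    Set (S → C → A → ℝ) :=
  {π | π ∈ policies S A C ∧ ∀ π' ∈ policies S A C,
    M.objective ψ πE π ≤ M.objective ψ πE π'}

/-- The set of task-extended occupancy measures, described by the Bellman constraint. -/
def bellmanSet (M : TaskMDP S A C) : Set (S × A × C → ℝ) :=
  {ρ | (∀ x, 0 ≤ ρ x) ∧ ∀ s c, ∑ a, ρ (s, a, c) =
    M.p c * M.ρ₀ s + M.γ * ∑ s', ∑ a, M.P s' a s * ρ (s', a, c)}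

/-- The entropy as a function of the occupancy measure, through
`π(a | s, c) = ρ(s, a, c) / ∑_{a'} ρ(s, a', c)`. -/
def occEntropy (ρ : S × A × C → ℝ) : ℝ :=
  - ∑ s, ∑ a, ∑ c, ρ (s, a, c) * Real.log (ρ (s, a, c) / ∑ a', ρ (s, a', c))

/-- The objective as a function of the two variables `ρ` and `l`:
`- H(ρ) + ∑ (ρ - ρ_E) l - ψ(l)`; its supremum over `l` is `- H(ρ) + ψ*(ρ - ρ_E)`. -/
def lagrangian (M : TaskMDP S A C) (ψ : (S × A × C → ℝ) → EReal) (πE : S → C → A → ℝ)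
    (ρ l : S × A × C → ℝ) : EReal :=
  ((- occEntropy ρ + ∑ x, (ρ x - M.occupancy πE x) * l x : ℝ) : EReal) - ψ l

/-- `(ρ, l)` is a saddle point of `lagrangian`: `ρ` minimizes over the occupancy measures, `l`
maximizes over all cost functions. -/
def IsSaddle (M : TaskMDP S A C) (ψ : (S × A × C → ℝ) → EReal) (πE : S → C → A → ℝ)
    (ρ l : S × A × C → ℝ) : Prop :=
  ρ ∈ M.bellmanSet ∧ IsSaddlePointOn M.bellmanSet Set.univ (M.lagrangian ψ πE) ρ l

end TaskMDP

end

end TaskIRL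

namespace TaskIRL

set_option linter.unusedSectionVars false

open Finset

/-! ### State distributions and discounted visits. -/

namespace TaskMDP

variable {S A C : Type*} [Fintype S] [Fintype A] [Fintype C]

/-! The problem is moved from policies to occupancy measures, where it becomes convex. The Bellman
constraint makes the marginal a fixed point of a `γ`-contraction determined by the policy, so
`occupancy` maps `policies` onto `bellmanSet` (`image_occupancy`), a compact convex set. There the
entropy depends on `ρ` alone, the expected cost is linear in `ρ`, and `- occEntropy` is continuous
and strictly convex: Gibbs' inequality supplies supporting linear functionals, and equality at two
points would force a common policy, hence equal measures (`strictConvexOn_neg_occEntropy`).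

IRL is then the dual problem, sup over `l` of min over `ρ` of the Lagrangian, and the regularized
matching problem is the primal one. Sion's theorem, applied on the epigraph of `ψ`, gives equality
of values (`minimax_saddleFun`). At a dual solution `l`, every primal solution minimizes the
Lagrangian; strict convexity allows only one minimizer, so the converse holds too. This is why `RL
l` contains no policies beyond the solutions (`isMinOn_saddleFun_iff`). Policies that differ only at
unvisited states share an occupancy measure, so equality of minimizing measures gives equality of
sets of policies. -/

lemma stateProb_nonneg (M : TaskMDP S A C) {π : S → C → A → ℝ} (hπ : π ∈ policies S A C)
    (c : C) (t : ℕ) (s : S) : 0 ≤ M.stateProb π c t s := by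
  induction t generalizing s with
  | zero => exact M.ρ₀_mem.1 s
  | succ t ih =>
    exact sum_nonneg fun s' _ => sum_nonneg fun a _ =>
      mul_nonneg (mul_nonneg (ih s') ((hπ s' c).1 a)) ((M.P_mem s' a).1 s)

lemma sum_stateProb (M : TaskMDP S A C) {π : S → C → A → ℝ} (hπ : π ∈ policies S A C)
    (c : C) (t : ℕ) : ∑ s, M.stateProb π c t s = 1 := by
  induction t with
  | zero => exact M.ρ₀_mem.2
  | succ t ih =>
    calc ∑ s', ∑ s, ∑ a, M.stateProb π c t s * π s c a * M.P s a s'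
        = ∑ s, ∑ a, ∑ s', M.stateProb π c t s * π s c a * M.P s a s' := by
          rw [sum_comm]
          exact sum_congr rfl fun s _ => sum_comm
      _ = 1 := by
          simp only [← mul_sum, (M.P_mem _ _).2, mul_one, (hπ _ _).2, ih]

lemma stateProb_le_one (M : TaskMDP S A C) {π : S → C → A → ℝ} (hπ : π ∈ policies S A C)
    (c : C) (t : ℕ) (s : S) : M.stateProb π c t s ≤ 1 :=
  (M.sum_stateProb hπ c t) ▸
    single_le_sum (fun s _ => M.stateProb_nonneg hπ c t s) (mem_univ s)

lemma policies_le_one {π : S → C → A → ℝ} (hπ : π ∈ policies S A C) (s : S) (c : C) (a : A) :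
    π s c a ≤ 1 :=
  (hπ s c).2 ▸ single_le_sum (fun a _ => (hπ s c).1 a) (mem_univ a)

/-- The discounted expected number of visits to a state, given the task. -/
noncomputable def visits (M : TaskMDP S A C) (π : S → C → A → ℝ) (c : C) (s : S) : ℝ :=
  ∑' t : ℕ, M.γ ^ t * M.stateProb π c t s

lemma discounted_stateProb_le (M : TaskMDP S A C) {π : S → C → A → ℝ}
    (hπ : π ∈ policies S A C) (c : C) (s : S) (t : ℕ) :
    M.γ ^ t * M.stateProb π c t s ≤ M.γ ^ t :=
  mul_le_of_le_one_right (pow_nonneg M.γ_nonneg t) (M.stateProb_le_one hπ c t s)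

lemma summable_visits (M : TaskMDP S A C) {π : S → C → A → ℝ} (hπ : π ∈ policies S A C)
    (c : C) (s : S) : Summable fun t : ℕ => M.γ ^ t * M.stateProb π c t s :=
  Summable.of_nonneg_of_le
    (fun t => mul_nonneg (pow_nonneg M.γ_nonneg t) (M.stateProb_nonneg hπ c t s))
    (M.discounted_stateProb_le hπ c s) (summable_geometric_of_lt_one M.γ_nonneg M.γ_lt_one)

lemma visits_nonneg (M : TaskMDP S A C) {π : S → C → A → ℝ} (hπ : π ∈ policies S A C)
    (c : C) (s : S) : 0 ≤ M.visits π c s :=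
  tsum_nonneg fun t => mul_nonneg (pow_nonneg M.γ_nonneg t) (M.stateProb_nonneg hπ c t s)

lemma visits_le (M : TaskMDP S A C) {π : S → C → A → ℝ} (hπ : π ∈ policies S A C)
    (c : C) (s : S) : M.visits π c s ≤ (1 - M.γ)⁻¹ := by
  rw [← tsum_geometric_of_lt_one M.γ_nonneg M.γ_lt_one]
  exact (M.summable_visits hπ c s).tsum_le_tsum (M.discounted_stateProb_le hπ c s)
    (summable_geometric_of_lt_one M.γ_nonneg M.γ_lt_one)

/-- Split off the term `t = 0` of the series and apply one transition to the rest. -/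
lemma visits_eq (M : TaskMDP S A C) {π : S → C → A → ℝ} (hπ : π ∈ policies S A C)
    (c : C) (s' : S) :
    M.visits π c s' =
      M.ρ₀ s' + M.γ * ∑ s, ∑ a, M.P s a s' * (M.visits π c s * π s c a) := by
  have h : HasSum (fun t : ℕ => M.γ ^ (t + 1) * M.stateProb π c (t + 1) s')
      (M.γ * ∑ s, ∑ a, M.P s a s' * (M.visits π c s * π s c a)) := by
    have h1 : HasSum (fun t : ℕ => M.γ * ∑ s, ∑ a,
        M.P s a s' * ((M.γ ^ t * M.stateProb π c t s) * π s c a))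
        (M.γ * ∑ s, ∑ a, M.P s a s' * (M.visits π c s * π s c a)) :=
      (hasSum_sum fun s _ => hasSum_sum fun a _ =>
        ((M.summable_visits hπ c s).hasSum.mul_right _).mul_left _).mul_left _
    refine h1.congr_fun ?_
    intro t
    simp only [stateProb, mul_sum]
    refine sum_congr rfl fun s _ => sum_congr rfl fun a _ => ?_
    ring
  rw [visits, (M.summable_visits hπ c s').tsum_eq_zero_add, h.tsum_eq]
  simp [stateProb]

lemma occupancy_apply (M : TaskMDP S A C) (π : S → C → A → ℝ) (s : S) (a : A) (c : C) :
    M.occupancy π (s, a, c) = M.p c * M.visits π c s * π s c a := by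
  simp only [occupancy, visits, ← mul_assoc, tsum_mul_right]

lemma expect_eq (M : TaskMDP S A C) {π : S → C → A → ℝ} (hπ : π ∈ policies S A C)
    (l : S × A × C → ℝ) : M.expect π l = ∑ x, M.occupancy π x * l x := by
  have h : HasSum (fun t : ℕ => ∑ c, ∑ s, ∑ a,
      M.p c * (M.γ ^ t * M.stateProb π c t s) * π s c a * l (s, a, c))
      (∑ c, ∑ s, ∑ a, M.p c * M.visits π c s * π s c a * l (s, a, c)) :=
    hasSum_sum fun c _ => hasSum_sum fun s _ => hasSum_sum fun a _ =>
      (((M.summable_visits hπ c s).hasSum.mul_left _).mul_right _).mul_right _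
  have h' : M.expect π l = ∑ c, ∑ s, ∑ a, M.p c * M.visits π c s * π s c a * l (s, a, c) := by
    rw [← h.tsum_eq, expect]
    refine tsum_congr fun t => ?_
    simp only [mul_sum]
    refine sum_congr rfl fun c _ => sum_congr rfl fun s _ => sum_congr rfl fun a _ => ?_
    ring
  rw [h', sum_comm]
  simp only [Fintype.sum_prod_type, occupancy_apply]
  exact sum_congr rfl fun s _ => sum_comm

/-! ### Correspondence between policies and the Bellman set. -/

/-- The marginal of an occupancy measure on states and tasks. -/
noncomputable def marginal (ρ : S × A × C → ℝ) (s : S) (c : C) : ℝ :=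
  ∑ a, ρ (s, a, c)

/-- `ρ` is compatible with `π` if `π` is a conditional distribution of the action under `ρ`. -/
def Compatible (ρ : S × A × C → ℝ) (π : S → C → A → ℝ) : Prop :=
  ∀ s a c, ρ (s, a, c) = marginal ρ s c * π s c a

lemma marginal_occupancy (M : TaskMDP S A C) {π : S → C → A → ℝ} (hπ : π ∈ policies S A C)
    (s : S) (c : C) : marginal (M.occupancy π) s c = M.p c * M.visits π c s := by
  simp only [marginal, occupancy_apply, ← mul_sum, (hπ s c).2, mul_one]

lemma compatible_occupancy (M : TaskMDP S A C) {π : S → C → A → ℝ} (hπ : π ∈ policies S A C) :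
    Compatible (M.occupancy π) π := fun s a c => by
  rw [M.marginal_occupancy hπ, occupancy_apply]

lemma occupancy_mem_bellmanSet (M : TaskMDP S A C) {π : S → C → A → ℝ}
    (hπ : π ∈ policies S A C) : M.occupancy π ∈ M.bellmanSet := by
  refine ⟨fun ⟨s, a, c⟩ => ?_, fun s c => ?_⟩
  · rw [occupancy_apply]
    exact mul_nonneg (mul_nonneg (M.p_mem.1 c) (M.visits_nonneg hπ c s)) ((hπ s c).1 a)
  · have h := M.marginal_occupancy hπ s c
    rw [marginal] at h
    rw [h, M.visits_eq hπ]
    simp only [occupancy_apply, mul_add, mul_sum]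
    congr 1
    refine sum_congr rfl fun s _ => sum_congr rfl fun a _ => ?_
    ring

lemma marginal_nonneg {ρ : S × A × C → ℝ} (hρ : ∀ x, 0 ≤ ρ x) (s : S) (c : C) :
    0 ≤ marginal ρ s c :=
  sum_nonneg fun _ _ => hρ _

lemma eq_zero_of_marginal_eq_zero {ρ : S × A × C → ℝ} (hρ : ∀ x, 0 ≤ ρ x) {s : S} {c : C}
    (h : marginal ρ s c = 0) (a : A) : ρ (s, a, c) = 0 :=
  (sum_eq_zero_iff_of_nonneg fun _ _ => hρ _).1 h a (mem_univ a)

lemma exists_compatible {π₀ : S → C → A → ℝ} (hπ₀ : π₀ ∈ policies S A C)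
    {ρ : S × A × C → ℝ} (hρ : ∀ x, 0 ≤ ρ x) : ∃ π ∈ policies S A C, Compatible ρ π := by
  classical
  -- Where the marginal vanishes the quotient is identically `0`, not a distribution, so `π₀` fills
  -- in. Its existence also excludes an empty action set when there are states and tasks.
  refine ⟨fun s c a => if marginal ρ s c = 0 then π₀ s c a else ρ (s, a, c) / marginal ρ s c,
    fun s c => ?_, fun s a c => ?_⟩
  · by_cases h : marginal ρ s c = 0
    · simpa only [h, if_true] using hπ₀ s c
    · simp only [h, if_false]
      refine ⟨fun a => div_nonneg (hρ _) (marginal_nonneg hρ s c), ?_⟩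
      rw [← sum_div]
      exact div_self h
  · by_cases h : marginal ρ s c = 0
    · simp [h, eq_zero_of_marginal_eq_zero hρ h a]
    · simp only [h, if_false]
      field_simp

/-- The Bellman constraint determines an occupancy measure from its policy. -/
lemma eq_of_compatible (M : TaskMDP S A C) {π : S → C → A → ℝ} (hπ : π ∈ policies S A C)
    {ρ ρ' : S × A × C → ℝ} (hρ : ρ ∈ M.bellmanSet) (hρ' : ρ' ∈ M.bellmanSet)
    (h : Compatible ρ π) (h' : Compatible ρ' π) : ρ = ρ' := by
  suffices H : ∀ s c, marginal ρ s c = marginal ρ' s c by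
    ext ⟨s, a, c⟩
    rw [h, h', H]
  intro s c
  set d : S → ℝ := fun s => marginal ρ s c - marginal ρ' s c with hd
  have hrec : ∀ s, d s = M.γ * ∑ s', ∑ a, M.P s' a s * (d s' * π s' c a) := by
    intro s
    have h1 : marginal ρ s c = _ := hρ.2 s c
    have h2 : marginal ρ' s c = _ := hρ'.2 s c
    simp only [hd]
    rw [h1, h2, add_sub_add_left_eq_sub, ← mul_sub, ← sum_sub_distrib]
    simp only [← sum_sub_distrib, ← mul_sub, sub_mul]
    simp only [← h _ _ _, ← h' _ _ _]
  -- The difference of marginals is `γ` times its image under a stochastic kernel, which does not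
  -- increase the ℓ¹ norm; since `γ < 1` it must vanish.
  have hle : ∑ s, |d s| ≤ M.γ * ∑ s, |d s| := by
    calc ∑ s, |d s| ≤ ∑ s, M.γ * ∑ s', ∑ a, M.P s' a s * (|d s'| * π s' c a) := by
          refine sum_le_sum fun s _ => ?_
          rw [hrec s, abs_mul, abs_of_nonneg M.γ_nonneg]
          refine mul_le_mul_of_nonneg_left ?_ M.γ_nonneg
          refine (abs_sum_le_sum_abs _ _).trans (sum_le_sum fun s' _ => ?_)
          refine (abs_sum_le_sum_abs _ _).trans (sum_le_sum fun a _ => ?_)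
          rw [abs_mul, abs_mul, abs_of_nonneg ((M.P_mem s' a).1 s),
            abs_of_nonneg ((hπ s' c).1 a)]
      _ = M.γ * ∑ s', ∑ a, ∑ s, M.P s' a s * (|d s'| * π s' c a) := by
          rw [← mul_sum, sum_comm]
          congr 1
          exact sum_congr rfl fun s _ => sum_comm
      _ = M.γ * ∑ s, |d s| := by
          simp only [← sum_mul, (M.P_mem _ _).2, one_mul, ← mul_sum, (hπ _ _).2, mul_one]
  have h0 : ∑ s, |d s| = 0 := by
    have hn : 0 ≤ ∑ s, |d s| := sum_nonneg fun _ _ => abs_nonneg _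
    nlinarith [M.γ_lt_one]
  have := (sum_eq_zero_iff_of_nonneg fun s _ => abs_nonneg (d s)).1 h0 s (mem_univ s)
  exact sub_eq_zero.1 (abs_eq_zero.1 this)

lemma image_occupancy (M : TaskMDP S A C) {π₀ : S → C → A → ℝ} (hπ₀ : π₀ ∈ policies S A C) :
    M.occupancy '' policies S A C = M.bellmanSet := by
  refine Set.Subset.antisymm ?_ fun ρ hρ => ?_
  · rintro _ ⟨π, hπ, rfl⟩
    exact M.occupancy_mem_bellmanSet hπ
  · obtain ⟨π, hπ, h⟩ := exists_compatible hπ₀ hρ.1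
    exact ⟨π, hπ, M.eq_of_compatible hπ (M.occupancy_mem_bellmanSet hπ) hρ
      (M.compatible_occupancy hπ) h⟩

lemma occupancy_le (M : TaskMDP S A C) {π : S → C → A → ℝ} (hπ : π ∈ policies S A C)
    (x : S × A × C) : M.occupancy π x ≤ (1 - M.γ)⁻¹ := by
  obtain ⟨s, a, c⟩ := x
  have hp : M.p c ≤ 1 := M.p_mem.2 ▸ single_le_sum (fun c _ => M.p_mem.1 c) (mem_univ c)
  have hv := M.visits_nonneg hπ c s
  rw [occupancy_apply]
  calc M.p c * M.visits π c s * π s c a ≤ M.p c * M.visits π c s :=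
        mul_le_of_le_one_right (mul_nonneg (M.p_mem.1 c) hv) (policies_le_one hπ s c a)
    _ ≤ M.visits π c s := mul_le_of_le_one_left hv hp
    _ ≤ _ := M.visits_le hπ c s

/-! ### Compactness and convexity of the Bellman set. -/

lemma isClosed_bellmanSet (M : TaskMDP S A C) : IsClosed M.bellmanSet := by
  simp only [bellmanSet, Set.ofPred_and, Set.ofPred_forall]
  refine IsClosed.inter (isClosed_iInter fun x => ?_)
    (isClosed_iInter fun s => isClosed_iInter fun c => ?_)
  · exact isClosed_le continuous_const (continuous_apply x)
  · exact isClosed_eq (by fun_prop) (by fun_prop)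

lemma isCompact_bellmanSet (M : TaskMDP S A C) {π₀ : S → C → A → ℝ}
    (hπ₀ : π₀ ∈ policies S A C) : IsCompact M.bellmanSet := by
  refine (isCompact_Icc (a := fun _ : S × A × C => (0 : ℝ))
    (b := fun _ => (1 - M.γ)⁻¹)).of_isClosed_subset M.isClosed_bellmanSet fun ρ hρ => ?_
  refine ⟨hρ.1, ?_⟩
  rw [← M.image_occupancy hπ₀] at hρ
  obtain ⟨π, hπ, rfl⟩ := hρ
  exact M.occupancy_le hπ

lemma convex_bellmanSet (M : TaskMDP S A C) : Convex ℝ M.bellmanSet := by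
  rintro ρ ⟨h0, h⟩ ρ' ⟨h0', h'⟩ t t' ht ht' htt
  refine ⟨fun x => add_nonneg (mul_nonneg ht (h0 x)) (mul_nonneg ht' (h0' x)), fun s c => ?_⟩
  simp only [Pi.add_apply, Pi.smul_apply, smul_eq_mul, sum_add_distrib, mul_add, ← mul_sum,
    mul_left_comm _ t, mul_left_comm _ t', h, h']
  linear_combination (M.p c * M.ρ₀ s) * htt

/-! ### Entropy of occupancy measures: continuity and strict convexity. -/

lemma occEntropy_eq_sum (ρ : S × A × C → ℝ) :
    occEntropy ρ = - ∑ x, ρ x * Real.log (ρ x / marginal ρ x.1 x.2.2) := by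
  simp only [occEntropy, Fintype.sum_prod_type, marginal]

lemma Compatible.mul_log {ρ : S × A × C → ℝ} {π : S → C → A → ℝ} (h : Compatible ρ π)
    (x : S × A × C) :
    ρ x * Real.log (ρ x / marginal ρ x.1 x.2.2) = ρ x * Real.log (π x.1 x.2.2 x.2.1) := by
  obtain ⟨s, a, c⟩ := x
  by_cases h0 : marginal ρ s c = 0
  · simp [h s a c, h0]
  · simp only
    rw [h s a c, mul_div_cancel_left₀ _ h0]

lemma Compatible.occEntropy_eq {ρ : S × A × C → ℝ} {π : S → C → A → ℝ} (h : Compatible ρ π) :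
    occEntropy ρ = - ∑ x, ρ x * Real.log (π x.1 x.2.2 x.2.1) := by
  rw [occEntropy_eq_sum]
  simp only [h.mul_log]

lemma entropy_eq (M : TaskMDP S A C) {π : S → C → A → ℝ} (hπ : π ∈ policies S A C) :
    M.entropy π = occEntropy (M.occupancy π) := by
  rw [entropy, M.expect_eq hπ, (M.compatible_occupancy hπ).occEntropy_eq]
  simp only [mul_neg, sum_neg_distrib]

/-- The quotient inside the logarithm is singular where the marginal vanishes. For nonnegative `ρ`
the sum splits into terms `x log x` in the entries and the marginals, and these are continuous at
`0` as well. -/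
lemma continuousOn_occEntropy :
    ContinuousOn (occEntropy (S := S) (A := A) (C := C)) {ρ | ∀ x, 0 ≤ ρ x} := by
  have hc : Continuous fun ρ : S × A × C → ℝ =>
      - (∑ s, ∑ c, (∑ a, ρ (s, a, c) * Real.log (ρ (s, a, c))
        - marginal ρ s c * Real.log (marginal ρ s c))) := by
    refine (continuous_finsetSum _ fun s _ => continuous_finsetSum _ fun c _ => ?_).neg
    refine (continuous_finsetSum _ fun a _ => ?_).sub ?_
    · exact Real.continuous_mul_log.comp (continuous_apply _)
    · refine Real.continuous_mul_log.comp ?_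
      unfold marginal
      fun_prop
  refine hc.continuousOn.congr fun ρ hρ => ?_
  simp only [occEntropy]
  congr 1
  refine sum_congr rfl fun s _ => ?_
  rw [sum_comm]
  refine sum_congr rfl fun c _ => ?_
  have h : marginal ρ s c * Real.log (marginal ρ s c)
      = ∑ a, ρ (s, a, c) * Real.log (marginal ρ s c) := by
    rw [← sum_mul, marginal]
  rw [h, ← sum_sub_distrib]
  refine sum_congr rfl fun a _ => ?_
  change ρ (s, a, c) * Real.log (ρ (s, a, c) / marginal ρ s c) = _
  by_cases h0 : ρ (s, a, c) = 0
  · simp [h0]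
  · have hm : marginal ρ s c ≠ 0 := fun hm => h0 (eq_zero_of_marginal_eq_zero hρ hm a)
    rw [Real.log_div h0 hm, mul_sub]

/-- The pointwise inequality behind Gibbs' inequality. -/
lemma mul_log_add_le {u σ q : ℝ} (hu : 0 ≤ u) (huσ : u ≤ σ) (hq : 0 ≤ q)
    (huq : u ≠ 0 → q ≠ 0) : u * Real.log q + (u - σ * q) ≤ u * Real.log (u / σ) := by
  rcases hu.eq_or_lt with rfl | hu
  · simpa using mul_nonneg huσ hq
  · have hσ := hu.trans_le huσ
    have hq : 0 < q := hq.lt_of_ne' (huq hu.ne')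
    -- This is `log x ≤ x - 1` at `x = σ q / u`, to be multiplied by `u`; it is strict unless `u = σ
    -- q`.
    have h := Real.log_le_sub_one_of_pos (show 0 < σ * q / u by positivity)
    rw [Real.log_div (by positivity) hu.ne', Real.log_mul hσ.ne' hq.ne'] at h
    rw [Real.log_div hu.ne' hσ.ne']
    have h2 := mul_le_mul_of_nonneg_left h hu.le
    have h3 : u * (σ * q / u - 1) = σ * q - u := by field_simp
    linarith

lemma mul_log_add_lt {u σ q : ℝ} (hu : 0 ≤ u) (huσ : u ≤ σ) (hq : 0 ≤ q)
    (huq : u ≠ 0 → q ≠ 0) (hne : u ≠ σ * q) :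
    u * Real.log q + (u - σ * q) < u * Real.log (u / σ) := by
  rcases hu.eq_or_lt with rfl | hu
  · simpa using (mul_nonneg huσ hq).lt_of_ne hne
  · have hσ := hu.trans_le huσ
    have hq : 0 < q := hq.lt_of_ne' (huq hu.ne')
    have h := Real.log_lt_sub_one_of_pos (show 0 < σ * q / u by positivity)
      (fun h => hne ((div_eq_one_iff_eq hu.ne').1 h).symm)
    rw [Real.log_div (by positivity) hu.ne', Real.log_mul hσ.ne' hq.ne'] at h
    rw [Real.log_div hu.ne' hσ.ne']
    have h2 := mul_lt_mul_of_pos_left h hu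
    have h3 : u * (σ * q / u - 1) = σ * q - u := by field_simp
    linarith

lemma le_marginal {ρ : S × A × C → ℝ} (hρ : ∀ x, 0 ≤ ρ x) (s : S) (a : A) (c : C) :
    ρ (s, a, c) ≤ marginal ρ s c :=
  single_le_sum (f := fun a => ρ (s, a, c)) (fun _ _ => hρ _) (mem_univ a)

lemma sum_sub_marginal_mul {π : S → C → A → ℝ} (hπ : π ∈ policies S A C)
    (ρ : S × A × C → ℝ) :
    ∑ x : S × A × C, (ρ x - marginal ρ x.1 x.2.2 * π x.1 x.2.2 x.2.1) = 0 := by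
  simp only [Fintype.sum_prod_type]
  refine sum_eq_zero fun s _ => ?_
  rw [sum_comm]
  refine sum_eq_zero fun c _ => ?_
  rw [sum_sub_distrib, ← mul_sum, (hπ s c).2, mul_one, marginal, sub_self]

/-- Gibbs' inequality: the pointwise corrections cancel in the sum because `π` is normalized. The
support condition is needed because `Real.log 0 = 0` would hide a value `-∞` on the left. -/
lemma sum_mul_log_le {π : S → C → A → ℝ} (hπ : π ∈ policies S A C)
    {ρ : S × A × C → ℝ} (hρ : ∀ x, 0 ≤ ρ x) (hac : ∀ s a c, ρ (s, a, c) ≠ 0 → π s c a ≠ 0) :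
    ∑ x, ρ x * Real.log (π x.1 x.2.2 x.2.1) ≤ - occEntropy ρ := by
  rw [occEntropy_eq_sum, neg_neg, ← add_zero (∑ x, ρ x * Real.log (π x.1 x.2.2 x.2.1)),
    ← sum_sub_marginal_mul hπ ρ, ← sum_add_distrib]
  exact sum_le_sum fun ⟨s, a, c⟩ _ =>
    mul_log_add_le (hρ _) (le_marginal hρ s a c) ((hπ s c).1 a) (hac s a c)

lemma sum_mul_log_lt {π : S → C → A → ℝ} (hπ : π ∈ policies S A C)
    {ρ : S × A × C → ℝ} (hρ : ∀ x, 0 ≤ ρ x) (hac : ∀ s a c, ρ (s, a, c) ≠ 0 → π s c a ≠ 0)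
    (hne : ¬ Compatible ρ π) :
    ∑ x, ρ x * Real.log (π x.1 x.2.2 x.2.1) < - occEntropy ρ := by
  rw [occEntropy_eq_sum, neg_neg, ← add_zero (∑ x, ρ x * Real.log (π x.1 x.2.2 x.2.1)),
    ← sum_sub_marginal_mul hπ ρ, ← sum_add_distrib]
  simp only [Compatible, not_forall] at hne
  obtain ⟨s, a, c, h⟩ := hne
  exact sum_lt_sum (fun ⟨s, a, c⟩ _ =>
    mul_log_add_le (hρ _) (le_marginal hρ s a c) ((hπ s c).1 a) (hac s a c))
    ⟨(s, a, c), mem_univ _,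
      mul_log_add_lt (hρ _) (le_marginal hρ s a c) ((hπ s c).1 a) (hac s a c) h⟩

/-- For the policy `π` of the mixture, the linear functional `∑ ρ log π` equals `- occEntropy` at
the mixture and lies below it at both endpoints. Equality at both would make them compatible with
the same `π`, hence equal by `eq_of_compatible`. -/
lemma strictConvexOn_neg_occEntropy (M : TaskMDP S A C) {π₀ : S → C → A → ℝ}
    (hπ₀ : π₀ ∈ policies S A C) : StrictConvexOn ℝ M.bellmanSet fun ρ => - occEntropy ρ := by
  refine ⟨M.convex_bellmanSet, fun ρ hρ ρ' hρ' hne t t' ht ht' htt => ?_⟩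
  have hmem := M.convex_bellmanSet hρ hρ' ht.le ht'.le htt
  obtain ⟨π, hπ, hcomp⟩ := exists_compatible hπ₀ hmem.1
  -- Both weights are positive, so the support of the mixture contains both supports; this is the
  -- condition for Gibbs' inequality.
  have hpos : ∀ s a c, π s c a = 0 → ρ (s, a, c) = 0 ∧ ρ' (s, a, c) = 0 := by
    intro s a c h0
    have h := hcomp s a c
    rw [h0, mul_zero] at h
    simp only [Pi.add_apply, Pi.smul_apply, smul_eq_mul] at h
    have h1 := mul_nonneg ht.le (hρ.1 (s, a, c))
    have h2 := mul_nonneg ht'.le (hρ'.1 (s, a, c))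
    obtain ⟨h3, h4⟩ := (add_eq_zero_iff_of_nonneg h1 h2).1 h
    exact ⟨(mul_eq_zero.1 h3).resolve_left ht.ne', (mul_eq_zero.1 h4).resolve_left ht'.ne'⟩
  have hac : ∀ s a c, ρ (s, a, c) ≠ 0 → π s c a ≠ 0 := fun s a c h h0 => h (hpos s a c h0).1
  have hac' : ∀ s a c, ρ' (s, a, c) ≠ 0 → π s c a ≠ 0 := fun s a c h h0 => h (hpos s a c h0).2
  have hle := sum_mul_log_le hπ hρ.1 hac
  have hle' := sum_mul_log_le hπ hρ'.1 hac'
  simp only [smul_eq_mul]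
  rw [hcomp.occEntropy_eq, neg_neg]
  simp only [Pi.add_apply, Pi.smul_apply, smul_eq_mul, add_mul, sum_add_distrib, mul_assoc,
    ← mul_sum]
  by_cases hc : Compatible ρ π
  · have hc' : ¬ Compatible ρ' π := fun hc' => hne (M.eq_of_compatible hπ hρ hρ' hc hc')
    have hlt' := sum_mul_log_lt hπ hρ'.1 hac' hc'
    exact add_lt_add_of_le_of_lt (mul_le_mul_of_nonneg_left hle ht.le)
      (mul_lt_mul_of_pos_left hlt' ht')
  · have hlt := sum_mul_log_lt hπ hρ.1 hac hc
    exact add_lt_add_of_lt_of_le (mul_lt_mul_of_pos_left hlt ht)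
      (mul_le_mul_of_nonneg_left hle' ht'.le)

end TaskMDP

end TaskIRL

namespace TaskIRL

open Finset

/-! ### Abstract minimax duality on a compact convex set. -/

section Duality

variable {ι : Type*} [Fintype ι]

/-- The function `h(ρ) + ⟨ρ - ρ₀, l⟩ - ψ(l)` of the two variables `ρ` and `l`. -/
noncomputable def saddleFun (h : (ι → ℝ) → ℝ) (ρ₀ : ι → ℝ) (ψ : (ι → ℝ) → EReal)
    (ρ l : ι → ℝ) : EReal :=
  ((h ρ + ∑ x, (ρ x - ρ₀ x) * l x : ℝ) : EReal) - ψ l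

variable {h : (ι → ℝ) → ℝ} {ρ₀ : ι → ℝ} {ψ : (ι → ℝ) → EReal} {X : Set (ι → ℝ)}

lemma saddleFun_of_top (ρ : ι → ℝ) {l : ι → ℝ} (hl : ψ l = ⊤) : saddleFun h ρ₀ ψ ρ l = ⊥ := by
  rw [saddleFun, hl, EReal.sub_top]

lemma saddleFun_of_coe (ρ : ι → ℝ) {l : ι → ℝ} {r : ℝ} (hl : ψ l = r) :
    saddleFun h ρ₀ ψ ρ l = ((h ρ + ∑ x, (ρ x - ρ₀ x) * l x - r : ℝ) : EReal) := by
  rw [saddleFun, hl, EReal.coe_sub]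

lemma ProperFun.top_or_coe {E : Type*} {ψ : E → EReal} (hψ : ProperFun ψ) (l : E) :
    ψ l = ⊤ ∨ ∃ r : ℝ, ψ l = r := by
  rcases eq_or_ne (ψ l) ⊤ with h | h
  · exact .inl h
  · exact .inr ⟨_, (EReal.coe_toReal h (hψ.1 l)).symm⟩

lemma ProperFun.exists_coe {E : Type*} {ψ : E → EReal} (hψ : ProperFun ψ) :
    ∃ l, ∃ r : ℝ, ψ l = r := by
  obtain ⟨l, hl⟩ := hψ.2
  exact ⟨l, (hψ.top_or_coe l).resolve_left hl⟩

lemma continuousOn_add_pairing (hc : ContinuousOn h X) (l : ι → ℝ) :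
    ContinuousOn (fun ρ => h ρ + ∑ x, (ρ x - ρ₀ x) * l x) X :=
  hc.add (Continuous.continuousOn (by fun_prop))

lemma strictConvexOn_add_pairing (hs : StrictConvexOn ℝ X h) (l : ι → ℝ) :
    StrictConvexOn ℝ X fun ρ => h ρ + ∑ x, (ρ x - ρ₀ x) * l x := by
  refine hs.add_convexOn ⟨hs.1, fun ρ _ ρ' _ t t' _ _ htt => le_of_eq ?_⟩
  simp only [Pi.add_apply, Pi.smul_apply, smul_eq_mul, mul_sum, ← sum_add_distrib]
  refine sum_congr rfl fun x _ => ?_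
  linear_combination (ρ₀ x * l x) * htt

lemma lowerSemicontinuousOn_saddleFun (hc : ContinuousOn h X) (hψ : ProperFun ψ) (l : ι → ℝ) :
    LowerSemicontinuousOn (fun ρ => saddleFun h ρ₀ ψ ρ l) X := by
  rcases hψ.top_or_coe l with hl | ⟨r, hl⟩
  · simp only [saddleFun_of_top _ hl]
    exact lowerSemicontinuousOn_const
  · simp only [saddleFun_of_coe _ hl]
    exact (continuous_coe_real_ereal.comp_continuousOn
      ((continuousOn_add_pairing hc l).sub continuousOn_const)).lowerSemicontinuousOn

/-- Strong duality for `saddleFun`: the minimum over the compact set and the supremum over the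
linear forms can be exchanged. -/
lemma minimax_saddleFun (hne : X.Nonempty) (hX : IsCompact X) (hc : ContinuousOn h X)
    (hs : StrictConvexOn ℝ X h) (hconv : ConvexFun ψ) (hψ : ProperFun ψ) :
    (⨅ ρ ∈ X, ⨆ l, saddleFun h ρ₀ ψ ρ l) = ⨆ l, ⨅ ρ ∈ X, saddleFun h ρ₀ ψ ρ l := by
  refine le_antisymm ?_ ?_
  -- Replacing `ψ l` by a height `q.2` over the epigraph makes the payoff real-valued, and affine
  -- and continuous in `q`. Sion's theorem thus applies without semicontinuity of `ψ`.
  · let Y : Set ((ι → ℝ) × ℝ) := {q | ψ q.1 ≤ (q.2 : EReal)}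
    let g : (ι → ℝ) → (ι → ℝ) × ℝ → ℝ := fun ρ q => h ρ + ∑ x, (ρ x - ρ₀ x) * q.1 x - q.2
    have hmono : Monotone ((↑) : ℝ → EReal) := EReal.coe_strictMono.monotone
    have hmm := Sion.minimax' (f := fun ρ q => (g ρ q : EReal)) (X := X) (Y := Y) hne hs.1 hX
      (fun q _ => (continuous_coe_real_ereal.comp_continuousOn
        ((continuousOn_add_pairing hc q.1).sub continuousOn_const)).lowerSemicontinuousOn)
      (fun q _ => QuasiconvexOn.monotone_comp (g := Real.toEReal) hmono
        (((strictConvexOn_add_pairing hs q.1).convexOn.sub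
          (concaveOn_const q.2 hs.1)).quasiconvexOn))
      hconv
      (fun ρ _ => by
        have : Continuous (g ρ) := by fun_prop
        exact (continuous_coe_real_ereal.comp this).upperSemicontinuous.upperSemicontinuousOn _)
      (fun ρ _ => by
        have : ConcaveOn ℝ Y (g ρ) := by
          refine ⟨hconv, fun q _ q' _ t t' _ _ htt => le_of_eq ?_⟩
          simp only [g, Prod.fst_add, Prod.snd_add, Prod.smul_fst, Prod.smul_snd, Pi.add_apply,
            Pi.smul_apply, smul_eq_mul, mul_add, mul_left_comm _ t, mul_left_comm _ t',
            sum_add_distrib, ← mul_sum]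
          linear_combination (h ρ) * htt
        exact QuasiconcaveOn.monotone_comp (g := Real.toEReal) hmono this.quasiconcaveOn)
    calc (⨅ ρ ∈ X, ⨆ l, saddleFun h ρ₀ ψ ρ l) ≤ ⨅ ρ ∈ X, ⨆ q ∈ Y, (g ρ q : EReal) := by
          refine iInf₂_mono fun ρ _ => iSup_le fun l => ?_
          rcases hψ.top_or_coe l with hl | ⟨r, hl⟩
          · rw [saddleFun_of_top _ hl]
            exact bot_le
          · rw [saddleFun_of_coe _ hl]
            exact le_iSup₂_of_le (l, r) hl.le le_rfl
      _ = ⨆ q ∈ Y, ⨅ ρ ∈ X, (g ρ q : EReal) := hmm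
      _ ≤ _ := by
          refine iSup₂_le fun q hq => le_iSup_of_le q.1 (iInf₂_mono fun ρ _ => ?_)
          simp only [g, EReal.coe_sub]
          exact EReal.sub_le_sub le_rfl hq
  · exact iSup_le fun l => iInf₂_mono fun ρ _ => le_iSup (saddleFun h ρ₀ ψ ρ) l

lemma exists_isMinOn_iSup_saddleFun (hne : X.Nonempty) (hX : IsCompact X)
    (hc : ContinuousOn h X) (hψ : ProperFun ψ) :
    ∃ ρ ∈ X, IsMinOn (fun ρ => ⨆ l, saddleFun h ρ₀ ψ ρ l) X ρ :=
  LowerSemicontinuousOn.exists_isMinOn hne hX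
    (lowerSemicontinuousOn_iSup fun l => lowerSemicontinuousOn_saddleFun hc hψ l)

lemma exists_iInf_saddleFun_eq (hne : X.Nonempty) (hX : IsCompact X) (hc : ContinuousOn h X)
    (l : ι → ℝ) : ∃ ρ ∈ X, (⨅ ρ ∈ X, saddleFun h ρ₀ ψ ρ l) = saddleFun h ρ₀ ψ ρ l := by
  obtain ⟨ρ, hρ, hmin⟩ := hX.exists_isMinOn hne (continuousOn_add_pairing (ρ₀ := ρ₀) hc l)
  refine ⟨ρ, hρ, le_antisymm (iInf₂_le ρ hρ) (le_iInf₂ fun ρ' hρ' => ?_)⟩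
  exact EReal.sub_le_sub (EReal.coe_le_coe_iff.2 (hmin hρ')) le_rfl

/-- Where `ψ` is `⊤` the dual value is `⊥`, while a point of the domain of `ψ` has a real dual
value. -/
lemma exists_coe_of_isMax (hne : X.Nonempty) (hX : IsCompact X) (hc : ContinuousOn h X)
    (hψ : ProperFun ψ) {l : ι → ℝ}
    (hl : ∀ l', (⨅ ρ ∈ X, saddleFun h ρ₀ ψ ρ l') ≤ ⨅ ρ ∈ X, saddleFun h ρ₀ ψ ρ l) :
    ∃ r : ℝ, ψ l = r := by
  refine (hψ.top_or_coe l).resolve_left fun htop => ?_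
  obtain ⟨l', r, hr⟩ := hψ.exists_coe
  obtain ⟨ρ, hρ, heq⟩ := exists_iInf_saddleFun_eq (ψ := ψ) (ρ₀ := ρ₀) hne hX hc l'
  have h1 := (hl l').trans (iInf₂_le ρ hρ)
  rw [heq, saddleFun_of_top _ htop, saddleFun_of_coe _ hr] at h1
  exact EReal.coe_ne_bot _ (le_bot_iff.1 h1)

/-- Equality of the primal and dual values closes the chain between any two optimal solutions. -/
lemma isSaddlePointOn_of_isMin_of_isMax (hne : X.Nonempty) (hX : IsCompact X)
    (hc : ContinuousOn h X) (hs : StrictConvexOn ℝ X h) (hconv : ConvexFun ψ) (hψ : ProperFun ψ)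
    {ρ l : ι → ℝ} (hmin : IsMinOn (fun ρ => ⨆ l, saddleFun h ρ₀ ψ ρ l) X ρ)
    (hl : ∀ l', (⨅ ρ ∈ X, saddleFun h ρ₀ ψ ρ l') ≤ ⨅ ρ ∈ X, saddleFun h ρ₀ ψ ρ l) :
    IsSaddlePointOn X Set.univ (saddleFun h ρ₀ ψ) ρ l := fun ρ' hρ' l' _ =>
  calc saddleFun h ρ₀ ψ ρ l' ≤ ⨆ l, saddleFun h ρ₀ ψ ρ l := le_iSup _ l'
    _ ≤ ⨅ ρ ∈ X, ⨆ l, saddleFun h ρ₀ ψ ρ l := le_iInf₂ fun _ hρ => hmin hρ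
    _ = ⨆ l, ⨅ ρ ∈ X, saddleFun h ρ₀ ψ ρ l := minimax_saddleFun hne hX hc hs hconv hψ
    _ ≤ ⨅ ρ ∈ X, saddleFun h ρ₀ ψ ρ l := iSup_le hl
    _ ≤ saddleFun h ρ₀ ψ ρ' l := iInf₂_le ρ' hρ'

/-- At a dual solution, the minimizers of the Lagrangian are the primal solutions. -/
lemma isMinOn_saddleFun_iff (hne : X.Nonempty) (hX : IsCompact X)
    (hc : ContinuousOn h X) (hs : StrictConvexOn ℝ X h) (hconv : ConvexFun ψ) (hψ : ProperFun ψ)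
    {ρ l : ι → ℝ} (hρ : ρ ∈ X)
    (hl : ∀ l', (⨅ ρ ∈ X, saddleFun h ρ₀ ψ ρ l') ≤ ⨅ ρ ∈ X, saddleFun h ρ₀ ψ ρ l) :
    IsMinOn (fun ρ => saddleFun h ρ₀ ψ ρ l) X ρ ↔
      IsMinOn (fun ρ => ⨆ l, saddleFun h ρ₀ ψ ρ l) X ρ := by
  refine ⟨fun hmin => ?_, fun hmin ρ' hρ' =>
    isSaddlePointOn_of_isMin_of_isMax hne hX hc hs hconv hψ hmin hl ρ' hρ' l (Set.mem_univ l)⟩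
  -- A primal solution `ρ₁` also minimizes the Lagrangian at `l`. As `ψ l` is finite, that
  -- Lagrangian is real and strictly convex in `ρ`, so `ρ = ρ₁`.
  obtain ⟨ρ₁, hρ₁, hmin₁⟩ := exists_isMinOn_iSup_saddleFun (ρ₀ := ρ₀) hne hX hc hψ
  have hmin₁' : IsMinOn (fun ρ => saddleFun h ρ₀ ψ ρ l) X ρ₁ := fun ρ' hρ' =>
    isSaddlePointOn_of_isMin_of_isMax hne hX hc hs hconv hψ hmin₁ hl ρ' hρ' l (Set.mem_univ l)
  obtain ⟨r, hr⟩ := exists_coe_of_isMax hne hX hc hψ hl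
  simp only [saddleFun_of_coe _ hr, isMinOn_iff, EReal.coe_le_coe_iff, sub_le_sub_iff_right]
    at hmin hmin₁'
  obtain rfl := (strictConvexOn_add_pairing (ρ₀ := ρ₀) hs l).eq_of_isMinOn hmin hmin₁' hρ hρ₁
  exact hmin₁

lemma isSaddlePointOn_saddleFun_iff (hne : X.Nonempty) (hX : IsCompact X)
    (hc : ContinuousOn h X) (hs : StrictConvexOn ℝ X h) (hconv : ConvexFun ψ) (hψ : ProperFun ψ)
    {ρ l : ι → ℝ} (hρ : ρ ∈ X) :
    IsSaddlePointOn X Set.univ (saddleFun h ρ₀ ψ) ρ l ↔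
      (∀ l', (⨅ ρ ∈ X, saddleFun h ρ₀ ψ ρ l') ≤ ⨅ ρ ∈ X, saddleFun h ρ₀ ψ ρ l) ∧
        IsMinOn (fun ρ => saddleFun h ρ₀ ψ ρ l) X ρ := by
  refine ⟨fun H => ⟨fun l' => le_iInf₂ fun ρ' hρ' => iInf₂_le_of_le ρ hρ
    (H ρ' hρ' l' (Set.mem_univ _)), fun ρ' hρ' => H ρ' hρ' l (Set.mem_univ _)⟩, fun ⟨hl, hmin⟩ => ?_⟩
  exact isSaddlePointOn_of_isMin_of_isMax hne hX hc hs hconv hψ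
    ((isMinOn_saddleFun_iff hne hX hc hs hconv hψ hρ hl).1 hmin) hl

lemma upperSemicontinuous_saddleFun (hlsc : LowerSemicontinuous ψ) (ρ : ι → ℝ) :
    UpperSemicontinuous (saddleFun h ρ₀ ψ ρ) := by
  have h1 : Continuous fun l : ι → ℝ => ((h ρ + ∑ x, (ρ x - ρ₀ x) * l x : ℝ) : EReal) :=
    continuous_coe_real_ereal.comp (by fun_prop)
  have h2 : UpperSemicontinuous fun l => - ψ l :=
    continuous_neg.comp_lowerSemicontinuous_antitone hlsc fun _ _ h => EReal.neg_le_neg_iff.2 h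
  exact h1.upperSemicontinuous.add' h2 fun l =>
    EReal.continuousAt_add (.inl (EReal.coe_ne_top _)) (.inl (EReal.coe_ne_bot _))

/-- The dual function is upper semicontinuous, as an infimum of such functions, and a nonempty
superlevel set of it lies in a compact sublevel set of `ψ`. -/
lemma exists_isMax_iInf_saddleFun (hX : IsCompact X) (hc : ContinuousOn h X)
    (hρ₀ : ρ₀ ∈ X) (hψ : ProperFun ψ) (hlsc : LowerSemicontinuous ψ)
    (hbdd : ∀ r : ℝ, Bornology.IsBounded {l | ψ l ≤ (r : EReal)}) :
    ∃ l, ∀ l', (⨅ ρ ∈ X, saddleFun h ρ₀ ψ ρ l') ≤ ⨅ ρ ∈ X, saddleFun h ρ₀ ψ ρ l := by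
  obtain ⟨l₀, r₀, hr₀⟩ := hψ.exists_coe
  obtain ⟨ρ₁, -, h₁⟩ := exists_iInf_saddleFun_eq (ψ := ψ) (ρ₀ := ρ₀) ⟨ρ₀, hρ₀⟩ hX hc l₀
  rw [saddleFun_of_coe _ hr₀] at h₁
  generalize h ρ₁ + ∑ x, (ρ₁ x - ρ₀ x) * l₀ x - r₀ = g at h₁
  -- Testing the infimum at `ρ₀` removes the linear term and leaves `h ρ₀ - ψ l`. The level `g` is
  -- the dual value at `l₀`.
  have hsub : ∀ l, (g : EReal) ≤ ⨅ ρ ∈ X, saddleFun h ρ₀ ψ ρ l →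
      ψ l ≤ ((h ρ₀ - g : ℝ) : EReal) := by
    intro l hl
    have h2 := hl.trans (iInf₂_le ρ₀ hρ₀)
    rcases hψ.top_or_coe l with htop | ⟨r, hr⟩
    · rw [saddleFun_of_top _ htop, le_bot_iff] at h2
      exact absurd h2 (EReal.coe_ne_bot _)
    · rw [saddleFun_of_coe _ hr, EReal.coe_le_coe_iff] at h2
      simp only [sub_self, zero_mul, sum_const_zero, add_zero] at h2
      rw [hr, EReal.coe_le_coe_iff]
      linarith
  have hK : IsCompact {l | ψ l ≤ ((h ρ₀ - g : ℝ) : EReal)} :=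
    Metric.isCompact_of_isClosed_isBounded (hlsc.isClosed_preimage _) (hbdd _)
  have husc : UpperSemicontinuous fun l => ⨅ ρ ∈ X, saddleFun h ρ₀ ψ ρ l :=
    upperSemicontinuous_biInf fun ρ _ => upperSemicontinuous_saddleFun hlsc ρ
  obtain ⟨l, -, hl⟩ := (husc.upperSemicontinuousOn _).exists_isMaxOn ⟨l₀, hsub l₀ h₁.ge⟩ hK
  refine ⟨l, fun l' => ?_⟩
  rcases le_total (g : EReal) (⨅ ρ ∈ X, saddleFun h ρ₀ ψ ρ l') with h' | h'
  · exact hl (hsub l' h')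
  · exact h'.trans (h₁.symm.le.trans (hl (hsub l₀ h₁.ge)))

end Duality

/-! ### Translation of RL, IRL and the matching problem into the duality setting. -/

namespace TaskMDP

variable {S A C : Type*} [Fintype S] [Fintype A] [Fintype C]

lemma lagrangian_eq_saddleFun (M : TaskMDP S A C) (ψ : (S × A × C → ℝ) → EReal)
    (πE : S → C → A → ℝ) :
    M.lagrangian ψ πE = saddleFun (fun ρ => - occEntropy ρ) (M.occupancy πE) ψ :=
  rfl

lemma neg_entropy_add_expect (M : TaskMDP S A C) {πE π : S → C → A → ℝ}
    (hπE : πE ∈ policies S A C) (hπ : π ∈ policies S A C) (l : S × A × C → ℝ) :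
    - M.entropy π + M.expect π l =
      - occEntropy (M.occupancy π) + ∑ x, (M.occupancy π x - M.occupancy πE x) * l x
        + M.expect πE l := by
  rw [M.entropy_eq hπ, M.expect_eq hπ, M.expect_eq hπE]
  simp only [sub_mul, sum_sub_distrib]
  ring

/-- The entropy is a real constant with respect to `l`, so it can be moved through the supremum even
where the conjugate is infinite. -/
lemma objective_eq (M : TaskMDP S A C) (ψ : (S × A × C → ℝ) → EReal) (πE : S → C → A → ℝ)
    {π : S → C → A → ℝ} (hπ : π ∈ policies S A C) :
    M.objective ψ πE π = ⨆ l, M.lagrangian ψ πE (M.occupancy π) l := by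
  have hl : ∀ l, M.lagrangian ψ πE (M.occupancy π) l = ((- M.entropy π : ℝ) : EReal) +
      (((∑ x, (M.occupancy π - M.occupancy πE) x * l x : ℝ) : EReal) - ψ l) := by
    intro l
    rw [lagrangian, M.entropy_eq hπ, EReal.coe_add, sub_eq_add_neg, sub_eq_add_neg, add_assoc]
    rfl
  refine le_antisymm ?_ (iSup_le fun l => ?_)
  · rw [objective, add_comm, ← EReal.le_sub_iff_add_le (.inl (EReal.coe_ne_bot _))
      (.inl (EReal.coe_ne_top _))]
    refine iSup_le fun l => ?_
    rw [EReal.le_sub_iff_add_le (.inl (EReal.coe_ne_bot _)) (.inl (EReal.coe_ne_top _)), add_comm,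
      ← hl]
    exact le_iSup (M.lagrangian ψ πE (M.occupancy π)) l
  · rw [hl, objective]
    exact add_le_add le_rfl
      (le_iSup (fun l => ((∑ x, (M.occupancy π - M.occupancy πE) x * l x : ℝ) : EReal) - ψ l) l)

lemma iInf_policies {β : Type*} [CompleteLattice β] (M : TaskMDP S A C) {πE : S → C → A → ℝ}
    (hπE : πE ∈ policies S A C) (f : (S × A × C → ℝ) → β) :
    ⨅ π ∈ policies S A C, f (M.occupancy π) = ⨅ ρ ∈ M.bellmanSet, f ρ := by
  rw [← M.image_occupancy hπE, iInf_image]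

lemma isMinOn_occupancy {β : Type*} [Preorder β] (M : TaskMDP S A C) {πE : S → C → A → ℝ}
    (hπE : πE ∈ policies S A C) (f : (S × A × C → ℝ) → β) (π : S → C → A → ℝ) :
    IsMinOn f M.bellmanSet (M.occupancy π) ↔
      ∀ π' ∈ policies S A C, f (M.occupancy π) ≤ f (M.occupancy π') := by
  rw [← M.image_occupancy hπE, isMinOn_iff, Set.forall_mem_image]

lemma continuousOn_neg_occEntropy (M : TaskMDP S A C) :
    ContinuousOn (fun ρ => - occEntropy ρ) M.bellmanSet :=
  (continuousOn_occEntropy.mono fun _ hρ => hρ.1).neg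

/-- Compactness makes the inner minimum an attained real number, so the expert's cost cancels in `ℝ`
and infinite values can come only from `ψ l`. -/
lemma irlObjective_eq (M : TaskMDP S A C) (ψ : (S × A × C → ℝ) → EReal) {πE : S → C → A → ℝ}
    (hπE : πE ∈ policies S A C) (l : S × A × C → ℝ) :
    M.irlObjective ψ πE l = ⨅ ρ ∈ M.bellmanSet, M.lagrangian ψ πE ρ l := by
  have hE := M.occupancy_mem_bellmanSet hπE
  let q : (S × A × C → ℝ) → ℝ := fun ρ =>
    - occEntropy ρ + ∑ x, (ρ x - M.occupancy πE x) * l x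
  obtain ⟨ρ, hρ, hmin⟩ := (M.isCompact_bellmanSet hπE).exists_isMinOn ⟨_, hE⟩
    (continuousOn_add_pairing (ρ₀ := M.occupancy πE) M.continuousOn_neg_occEntropy l)
  have hmin' : ∀ ρ' ∈ M.bellmanSet, q ρ ≤ q ρ' := fun ρ' hρ' => hmin hρ'
  have h1 : (⨅ ρ ∈ M.bellmanSet, M.lagrangian ψ πE ρ l) = q ρ - ψ l :=
    le_antisymm (iInf₂_le ρ hρ) (le_iInf₂ fun ρ' hρ' =>
      EReal.sub_le_sub (EReal.coe_le_coe_iff.2 (hmin' ρ' hρ')) le_rfl)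
  have h2 : (⨅ π ∈ policies S A C, ((- M.entropy π + M.expect π l : ℝ) : EReal))
      = ((q ρ + M.expect πE l : ℝ) : EReal) := by
    calc _ = ⨅ π ∈ policies S A C, ((q (M.occupancy π) + M.expect πE l : ℝ) : EReal) :=
          biInf_congr fun π hπ => by rw [M.neg_entropy_add_expect hπE hπ]
      _ = ⨅ ρ ∈ M.bellmanSet, ((q ρ + M.expect πE l : ℝ) : EReal) :=
          M.iInf_policies hπE fun ρ => ((q ρ + M.expect πE l : ℝ) : EReal)
      _ = _ := le_antisymm (iInf₂_le ρ hρ) (le_iInf₂ fun ρ' hρ' =>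
          EReal.coe_le_coe_iff.2 (by linarith [hmin' ρ' hρ']))
  rw [irlObjective, h1, h2, ← EReal.coe_sub, add_sub_cancel_right]

lemma mem_RL_iff (M : TaskMDP S A C) {πE : S → C → A → ℝ} (hπE : πE ∈ policies S A C)
    (l : S × A × C → ℝ) (π : S → C → A → ℝ) :
    π ∈ M.RL l ↔ π ∈ policies S A C ∧
      IsMinOn (fun ρ => - occEntropy ρ + ∑ x, (ρ x - M.occupancy πE x) * l x)
        M.bellmanSet (M.occupancy π) := by
  rw [M.isMinOn_occupancy hπE]
  refine and_congr_right fun hπ => forall₂_congr fun π' hπ' => ?_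
  rw [M.neg_entropy_add_expect hπE hπ, M.neg_entropy_add_expect hπE hπ', add_le_add_iff_right]

/-- Finiteness of `ψ l` is essential: for `ψ l = ⊤` the Lagrangian is constantly `⊥`, and every `ρ`
would be a minimizer. -/
lemma mem_RL_iff_lagrangian (M : TaskMDP S A C) {ψ : (S × A × C → ℝ) → EReal}
    {πE : S → C → A → ℝ} (hπE : πE ∈ policies S A C) {l : S × A × C → ℝ} {r : ℝ}
    (hl : ψ l = r) (π : S → C → A → ℝ) :
    π ∈ M.RL l ↔ π ∈ policies S A C ∧
      IsMinOn (fun ρ => M.lagrangian ψ πE ρ l) M.bellmanSet (M.occupancy π) := by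
  rw [M.mem_RL_iff hπE, lagrangian_eq_saddleFun]
  simp only [saddleFun_of_coe _ hl, isMinOn_iff, EReal.coe_le_coe_iff, sub_le_sub_iff_right]

lemma mem_solutions_iff (M : TaskMDP S A C) (ψ : (S × A × C → ℝ) → EReal)
    {πE : S → C → A → ℝ} (hπE : πE ∈ policies S A C) (π : S → C → A → ℝ) :
    π ∈ M.solutions ψ πE ↔ π ∈ policies S A C ∧
      IsMinOn (fun ρ => ⨆ l, M.lagrangian ψ πE ρ l) M.bellmanSet (M.occupancy π) := by
  rw [M.isMinOn_occupancy hπE]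
  refine and_congr_right fun hπ => forall₂_congr fun π' hπ' => ?_
  rw [M.objective_eq ψ πE hπ, M.objective_eq ψ πE hπ']

lemma mem_IRL_iff (M : TaskMDP S A C) (ψ : (S × A × C → ℝ) → EReal)
    {πE : S → C → A → ℝ} (hπE : πE ∈ policies S A C) (l : S × A × C → ℝ) :
    l ∈ M.IRL ψ πE ↔ ∀ l', (⨅ ρ ∈ M.bellmanSet, M.lagrangian ψ πE ρ l') ≤
      ⨅ ρ ∈ M.bellmanSet, M.lagrangian ψ πE ρ l := by
  refine forall_congr' fun l' => ?_
  rw [M.irlObjective_eq ψ hπE, M.irlObjective_eq ψ hπE]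

end TaskMDP

end TaskIRL

/-! ### The main theorem. -/

theorem proposition1 {S A C : Type*} [Fintype S] [Fintype A] [Fintype C]
    (M : TaskIRL.TaskMDP S A C)
    (πE : S → C → A → ℝ) (hπE : πE ∈ TaskIRL.policies S A C)
    (ψ : (S × A × C → ℝ) → EReal)
    (hconv : TaskIRL.ConvexFun ψ) (hproper : TaskIRL.ProperFun ψ) :
    -- both minimization problems over policies have solutions
    (M.solutions ψ πE).Nonempty ∧ (∀ l, (M.RL l).Nonempty) ∧
    -- the two optimal values agree
    (⨆ l, M.irlObjective ψ πE l) =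
      (⨅ π ∈ TaskIRL.policies S A C, M.objective ψ πE π) ∧
    -- every cost recovered by IRL leads exactly to the solutions of the problem
    (∀ l ∈ M.IRL ψ πE, M.RL l = M.solutions ψ πE) ∧
    -- if IRL has a solution, then RL ∘ IRL is the argmin, and there is a saddle point
    ((M.IRL ψ πE).Nonempty →
      M.RLcompIRL ψ πE = M.solutions ψ πE ∧ ∃ ρ l, M.IsSaddle ψ πE ρ l) ∧
    -- the saddle points are exactly the pairs produced by IRL followed by RL
    (∀ ρ l, M.IsSaddle ψ πE ρ l ↔
      l ∈ M.IRL ψ πE ∧ ∃ π ∈ M.RL l, ρ = M.occupancy π) ∧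
    -- IRL has a solution when the regularizer is closed with bounded sublevel sets
    (LowerSemicontinuous ψ → (∀ r : ℝ, Bornology.IsBounded {l | ψ l ≤ (r : EReal)}) →
      (M.IRL ψ πE).Nonempty) := by
  have hE := M.occupancy_mem_bellmanSet hπE
  have hne : M.bellmanSet.Nonempty := ⟨_, hE⟩
  have hX := M.isCompact_bellmanSet hπE
  have hc := M.continuousOn_neg_occEntropy
  have hs := M.strictConvexOn_neg_occEntropy hπE
  have hSol : (M.solutions ψ πE).Nonempty := by
    obtain ⟨ρ, hρ, hmin⟩ :=
      TaskIRL.exists_isMinOn_iSup_saddleFun (ρ₀ := M.occupancy πE) hne hX hc hproper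
    rw [← M.image_occupancy hπE] at hρ
    obtain ⟨π, hπ, rfl⟩ := hρ
    exact ⟨π, (M.mem_solutions_iff ψ hπE π).2 ⟨hπ, hmin⟩⟩
  have hRL : ∀ l, (M.RL l).Nonempty := by
    intro l
    obtain ⟨ρ, hρ, hmin⟩ := hX.exists_isMinOn hne
      (TaskIRL.continuousOn_add_pairing (ρ₀ := M.occupancy πE) hc l)
    rw [← M.image_occupancy hπE] at hρ
    obtain ⟨π, hπ, rfl⟩ := hρ
    exact ⟨π, (M.mem_RL_iff hπE l π).2 ⟨hπ, hmin⟩⟩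
  -- Finiteness of `ψ` at IRL solutions is what links `RL l`, which does not involve `ψ`, to
  -- minimizers of the Lagrangian.
  have hfin : ∀ l ∈ M.IRL ψ πE, ∃ r : ℝ, ψ l = r := fun l hl =>
    TaskIRL.exists_coe_of_isMax hne hX hc hproper ((M.mem_IRL_iff ψ hπE l).1 hl)
  have hEq : ∀ l ∈ M.IRL ψ πE, M.RL l = M.solutions ψ πE := by
    intro l hl
    obtain ⟨r, hr⟩ := hfin l hl
    ext π
    rw [M.mem_RL_iff_lagrangian hπE hr, M.mem_solutions_iff ψ hπE]
    exact and_congr_right fun hπ => TaskIRL.isMinOn_saddleFun_iff hne hX hc hs hconv hproper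
      (M.occupancy_mem_bellmanSet hπ) ((M.mem_IRL_iff ψ hπE l).1 hl)
  have hSaddle : ∀ ρ l, M.IsSaddle ψ πE ρ l ↔
      l ∈ M.IRL ψ πE ∧ ∃ π ∈ M.RL l, ρ = M.occupancy π := by
    intro ρ l
    constructor
    · rintro ⟨hρ, H⟩
      obtain ⟨hl, hmin⟩ :=
        (TaskIRL.isSaddlePointOn_saddleFun_iff hne hX hc hs hconv hproper hρ).1 H
      have hl' := (M.mem_IRL_iff ψ hπE l).2 hl
      obtain ⟨r, hr⟩ := hfin l hl'
      rw [← M.image_occupancy hπE] at hρ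
      obtain ⟨π, hπ, rfl⟩ := hρ
      exact ⟨hl', π, (M.mem_RL_iff_lagrangian hπE hr π).2 ⟨hπ, hmin⟩, rfl⟩
    · rintro ⟨hl, π, hπ, rfl⟩
      obtain ⟨r, hr⟩ := hfin l hl
      obtain ⟨hπ, hmin⟩ := (M.mem_RL_iff_lagrangian hπE hr π).1 hπ
      have hρ := M.occupancy_mem_bellmanSet hπ
      exact ⟨hρ, (TaskIRL.isSaddlePointOn_saddleFun_iff hne hX hc hs hconv hproper hρ).2
        ⟨(M.mem_IRL_iff ψ hπE l).1 hl, hmin⟩⟩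
  refine ⟨hSol, hRL, ?_, hEq, ?_, hSaddle, fun hlsc hbdd => ?_⟩
  · calc (⨆ l, M.irlObjective ψ πE l) = ⨆ l, ⨅ ρ ∈ M.bellmanSet, M.lagrangian ψ πE ρ l :=
          iSup_congr fun l => M.irlObjective_eq ψ hπE l
      _ = ⨅ ρ ∈ M.bellmanSet, ⨆ l, M.lagrangian ψ πE ρ l :=
          (TaskIRL.minimax_saddleFun hne hX hc hs hconv hproper).symm
      _ = ⨅ π ∈ TaskIRL.policies S A C, ⨆ l, M.lagrangian ψ πE (M.occupancy π) l :=
          (M.iInf_policies hπE _).symm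
      _ = _ := biInf_congr fun π hπ => (M.objective_eq ψ πE hπ).symm
  · rintro ⟨l, hl⟩
    obtain ⟨π, hπ⟩ := hRL l
    refine ⟨?_, M.occupancy π, l, (hSaddle _ l).2 ⟨hl, π, hπ, rfl⟩⟩
    ext π'
    refine ⟨fun ⟨l', hl', h⟩ => hEq l' hl' ▸ h, fun h => ⟨l, hl, (hEq l hl).symm ▸ h⟩⟩
  · obtain ⟨l, hl⟩ := TaskIRL.exists_isMax_iInf_saddleFun hX hc hE hproper hlsc hbdd
    exact ⟨l, (M.mem_IRL_iff ψ hπE l).2 hl⟩
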